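/- Let $\mathbb K=\mathbb R$ or $\mathbb C$, let $\mathcal A$ be a unital Banach algebra over $\mathbb K$ (complete, with $\|UV\|\le\|U\|\,\|V\|$), and let $X,Y\in\mathcal A$. Write $\mathrm{ad}_U V=UV-VU$. Define the exponents $C_k=C_k(X,Y)\in\mathcal A$, $k\ge 2$, of the symmetric Zassenhaus formula recursively as follows. Put $$f_{1,0}=g_{1,0}=\tfrac12(X+Y),$$ and for $\ell\ge 1$ $$f_{1,\ell}=\frac{(-1)^\ell}{2^\ell}\Big(\frac1{2\,\ell!}\mathrm{ad}_Y^\ell X+\sum_{j=0}^{\ell}\frac1{j!\,(\ell-j)!}\mathrm{ad}_Y^{\ell-j}\mathrm{ad}_X^jY\Big),\qquad g_{1,\ell}=\frac1{\ell!\,2^{\ell+1}}\mathrm{ad}_Y^\ell X .$$ For $k=3,5,7,\dots$ put successively $$C_k=\frac1{2k}\,(f_{k-2,k-1}-g_{k-2,k-1}),$$ $$f_{k,k-1}=f_{k-2,k-1}-kC_k,\qquad g_{k,k-1}=g_{k-2,k-1}+kC_k,$$ and, for $\ell\ge0$ with $\ell\ne k-1$, $$f_{k,\ell}=\sum_{j=0}^{\lfloor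 \ell/k\rfloor}\frac{(-1)^j}{j!}\mathrm{ad}_{C_k}^j f_{k-2,\ell-kj},\qquad g_{k,\ell}=\sum_{j=0}^{\lfloor \ell/k\rfloor}\frac{1}{j!}\mathrm{ad}_{C_k}^j g_{k-2,\ell-kj};$$ and put $C_k=0$ for every even $k\ge2$. For $n\ge2$ and $\lambda\in\mathbb K$ let $$\Psi_n(\lambda)=e^{\frac\lambda2X}e^{\frac\lambda2Y}e^{\lambda^2C_2}e^{\lambda^3C_3}\cdots e^{\lambda^nC_n}\;e^{\lambda^nC_n}\cdots e^{\lambda^3C_3}e^{\lambda^2C_2}e^{\frac\lambda2Y}e^{\frac\lambda2X},$$ and let $r_z\in[0,\infty]$ be the radius of convergence of the power series $$M(\lambda)=\lambda(\|X\|+\|Y\|)+2\sum_{j\ge2}\lambda^j\|C_j\|.$$ Then for every $\lambda\in B(0,r_z)=\{\lambda\in\mathbb K:|\lambda|<r_z\}$ $$\lim_{n\to\infty}\Psi_n(\lambda)=e^{\lambda(X+Y)},$$ and the convergence is uniform on every compact subset of $B(0,r_z)$. -/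

import Mathlib

open Filter Topology

namespace SymZassenhaus

noncomputable section

section Exponents

variable (𝕜 : Type*) [RCLike 𝕜] {A : Type*} [NormedRing A] [NormedAlgebra 𝕜 A]

/-- The iterated commutator `ad_a ^ j b`, where `ad_a b = [a, b] = a * b - b * a`. -/
def adPow (a : A) (j : ℕ) (b : A) : A := (fun c : A => a * c - c * a)^[j] b

/-- The initial coefficients `f_{1,ℓ}` of the recursion. -/
def fInit (X Y : A) (l : ℕ) : A :=
  if l = 0 then (1 / 2 : 𝕜) • (X + Y)
  else ((-1 : 𝕜) ^ l / 2 ^ l) •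
    ((1 / (2 * (l.factorial : 𝕜))) • adPow Y l X +
      ∑ j ∈ Finset.range (l + 1),
        (1 / ((j.factorial : 𝕜) * ((l - j).factorial : 𝕜))) • adPow Y (l - j) (adPow X j Y))

/-- The initial coefficients `g_{1,ℓ}` of the recursion. -/
def gInit (X Y : A) (l : ℕ) : A :=
  if l = 0 then (1 / 2 : 𝕜) • (X + Y)
  else (1 / ((l.factorial : 𝕜) * 2 ^ (l + 1))) • adPow Y l X

/-- The exponent `C_k = (f_{k-2,k-1} - g_{k-2,k-1}) / (2k)` computed from the sequences
`f = f_{k-2,·}` and `g = g_{k-2,·}`. -/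
def nextExponent (k : ℕ) (f g : ℕ → A) : A :=
  (1 / (2 * (k : 𝕜))) • (f (k - 1) - g (k - 1))

/-- The sequence `f_{k,·}` computed from `C = C_k` and `f = f_{k-2,·}`. -/
def fStep (k : ℕ) (C : A) (f : ℕ → A) (l : ℕ) : A :=
  if l = k - 1 then -((k : 𝕜) • C) + f (k - 1)
  else ∑ j ∈ Finset.range (l / k + 1),
    ((-1 : 𝕜) ^ j / (j.factorial : 𝕜)) • adPow C j (f (l - k * j))

/-- The sequence `g_{k,·}` computed from `C = C_k` and `g = g_{k-2,·}`. -/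
def gStep (k : ℕ) (C : A) (g : ℕ → A) (l : ℕ) : A :=
  if l = k - 1 then (k : 𝕜) • C + g (k - 1)
  else ∑ j ∈ Finset.range (l / k + 1),
    (1 / (j.factorial : 𝕜)) • adPow C j (g (l - k * j))

/-- `fg 𝕜 X Y m` is the pair of sequences `(f_{k,·}, g_{k,·})` with `k = 2m + 1`. -/
def fg (X Y : A) : ℕ → (ℕ → A) × (ℕ → A)
  | 0 => (fInit 𝕜 X Y, gInit 𝕜 X Y)
  | m + 1 =>
    let p := fg X Y m
    let C := nextExponent 𝕜 (2 * m + 3) p.1 p.2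
    (fStep 𝕜 (2 * m + 3) C p.1, gStep 𝕜 (2 * m + 3) C p.2)

/-- The exponents `C_k` of the symmetric Zassenhaus formula, for `k ≥ 2`: those of even degree
are `0`, and `C_{2m+3} = (f_{2m+1,2m+2} - g_{2m+1,2m+2}) / (2(2m+3))`. (The values at `k = 0, 1`
are set to `0` and are never used.) -/
def exponent (X Y : A) (k : ℕ) : A :=
  if 3 ≤ k ∧ Odd k then
    nextExponent 𝕜 k (fg 𝕜 X Y ((k - 3) / 2)).1 (fg 𝕜 X Y ((k - 3) / 2)).2
  else 0

/-- The factors `exp (z² C₂), exp (z³ C₃), …, exp (zⁿ Cₙ)`, in this order. -/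
def factors (X Y : A) (n : ℕ) (z : 𝕜) : List A :=
  (List.range' 2 (n - 1)).map fun j => NormedSpace.exp (z ^ j • exponent 𝕜 X Y j)

/-- The truncated left-right palindromic product `Ψₙ(z)` (for `n ≥ 2`). -/
def Psi (X Y : A) (n : ℕ) (z : 𝕜) : A :=
  NormedSpace.exp ((z / 2) • X) * NormedSpace.exp ((z / 2) • Y) * (factors 𝕜 X Y n z).prod *
    ((factors 𝕜 X Y n z).reverse.prod *
      NormedSpace.exp ((z / 2) • Y) * NormedSpace.exp ((z / 2) • X))

/-- The coefficients of the power series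
`M(t) = t (‖X‖ + ‖Y‖) + 2 ∑_{j ≥ 2} t ^ j ‖C_j‖`. -/
def majorantCoeff (X Y : A) (j : ℕ) : ℝ :=
  if j = 0 then 0 else if j = 1 then ‖X‖ + ‖Y‖ else 2 * ‖exponent 𝕜 X Y j‖

/-- The radius of convergence, in `[0, ∞]`, of the power series `M`. -/
def rz (X Y : A) : ENNReal :=
  (FormalMultilinearSeries.ofScalars ℝ (majorantCoeff 𝕜 X Y)).radius

end Exponents

end

end SymZassenhaus

/-!
Write `λ` for the formal variable. The proof works in the ring of formal power series `A⟦X⟧` over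
the noncommutative algebra `A`, with `expS 𝕜 k a` the formal series of `exp (λ^k a)`.

*Formal identity.* Let `R₁ = e^{-λY/2} e^{-λX/2} e^{λ(X+Y)} e^{-λX/2} e^{-λY/2}` and
`R_k = e^{-λ^k C_k} R_{k-2} e^{-λ^k C_k}` for odd `k ≥ 3` (`residual`). The recursion defining
`f_k` and `g_k` says exactly that `R_k' = F_k R_k - R_k G_k` for the generating series
`F_k = ∑ f_{k,ℓ} λ^ℓ` and `G_k = ∑ g_{k,ℓ} λ^ℓ` (`isSol_residual`): conjugating by `e^{λ^k C}`
turns `F` into `e^{λ^k ad C} F` (`adExp_mul_expS`) and adds the logarithmic derivative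
`k λ^{k-1} C`. Moreover, `R_k` is a palindromic product of exponentials of odd powers
of `λ`, so `R_k(-λ) R_k(λ) = 1` (`reflect_residual_mul`). Together these facts give
`R_k = 1 + O(λ^{k+2})` by induction (`flat_residual`): the differential equation identifies
the coefficient of `λ^k` in `R_{k-2}` as `(f_{k-2,k-1} - g_{k-2,k-1}) / k = 2 C_k`, which the
two factors `e^{-λ^k C_k}` remove, and the reflection symmetry kills the next, even,
coefficient. Undoing the conjugations, the series of `Ψ_n` agrees with that of `e^{λ(X+Y)}` up to
order `n` (`coeff_leftS_mul_rightS`).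

*Convergence.* For `r < r_z`, the weighted norm `∑ ‖p_m‖ r^m` (`wnorm`) of the series of `Ψ_n` is
at most `e^{M(r)}`, up to its constant term, uniformly in `n`. Since the difference of `Ψ_n` and
`e^{λ(X+Y)}` starts at order `n + 1`, it is at most `(ρ / r)^{n+1} 2 e^{M(r)}` on `|λ| ≤ ρ < r`
(`enorm_psi_sub_exp_le`), which tends to `0`.

The algebra is not assumed to satisfy `‖1‖ = 1`, so the multiplicative bounds are phrased for
`1 + wnorm r (p - 1)` (`ExpBound`), which ignores the norm of the unit.
-/

namespace SymZassenhaus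

noncomputable section

open PowerSeries Finset.HasAntidiagonal
open scoped ENNReal NNReal

/-! ### Formal exponentials -/

section Formal

variable (𝕜 : Type*) {A : Type*} [Field 𝕜] [Ring A] [Algebra 𝕜 A]

/-- The formal series of `exp (λ^k a)`, for `k ≥ 1`: its coefficient at `λ^(k i)` is
`a ^ i / i!`. -/
def expS (k : ℕ) (a : A) : A⟦X⟧ :=
  PowerSeries.mk fun n => if k ∣ n then ((n / k).factorial : 𝕜)⁻¹ • a ^ (n / k) else 0

/-- The commutator map `b ↦ a * b - b * a`. -/
def ad (a : A) : A →ₗ[𝕜] A := LinearMap.mulLeft 𝕜 a - LinearMap.mulRight 𝕜 a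

/-- The series `exp (λ^k ad a) p`, acting on the coefficients of `p`. -/
def adExp (k : ℕ) (a : A) (p : A⟦X⟧) : A⟦X⟧ :=
  PowerSeries.mk fun n => ∑ j ∈ Finset.range (n / k + 1),
    (j.factorial : 𝕜)⁻¹ • (ad 𝕜 a ^ j) (coeff (n - k * j) p)

/-- The Euler derivation `λ d/dλ`. It replaces `d/dλ`, as its Leibniz rule needs no shift of
indices. -/
def euler (p : A⟦X⟧) : A⟦X⟧ := PowerSeries.mk fun n => n • coeff n p

/-- The substitution `λ ↦ -λ`. -/
def reflect (p : A⟦X⟧) : A⟦X⟧ := PowerSeries.mk fun n => (-1) ^ n * coeff n p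

lemma sum_antidiagonal_eq_sum_multiples {M : Type*} [AddCommMonoid M] {k : ℕ} (hk : 0 < k) (n : ℕ)
    (f : ℕ → ℕ → M) (hf : ∀ i j, ¬ k ∣ i → f i j = 0) :
    ∑ ij ∈ antidiagonal n, f ij.1 ij.2 =
      ∑ i ∈ Finset.range (n / k + 1), f (k * i) (n - k * i) := by
  rw [Finset.Nat.sum_antidiagonal_eq_sum_range_succ f]
  symm
  apply Finset.sum_of_injOn (fun i => k * i)
  · intro i _ j _ h
    exact Nat.eq_of_mul_eq_mul_left hk h
  · intro i hi
    simp only [Finset.coe_range, Set.mem_Iio] at hi ⊢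
    have := Nat.mul_le_mul_left k (Nat.lt_succ_iff.1 hi)
    have := Nat.mul_div_le n k
    omega
  · intro m hm hm'
    refine hf _ _ ?_
    rintro ⟨i, rfl⟩
    refine hm' ⟨i, ?_, rfl⟩
    simp only [Finset.coe_range, Set.mem_Iio, Finset.mem_range] at hm ⊢
    have : i ≤ n / k := (Nat.le_div_iff_mul_le hk).2 (by rw [mul_comm]; omega)
    omega
  · intro i _
    rfl

lemma coeff_expS_mul {k : ℕ} (hk : 0 < k) (a : A) (p : A⟦X⟧) (n : ℕ) :
    coeff n (expS 𝕜 k a * p) = ∑ i ∈ Finset.range (n / k + 1),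
      (i.factorial : 𝕜)⁻¹ • (a ^ i * coeff (n - k * i) p) := by
  rw [coeff_mul, sum_antidiagonal_eq_sum_multiples hk n
    (fun i j => coeff i (expS 𝕜 k a) * coeff j p) fun i j h => by simp [expS, h]]
  exact Finset.sum_congr rfl fun i _ => by simp [expS, hk]

lemma coeff_mul_expS {k : ℕ} (hk : 0 < k) (a : A) (p : A⟦X⟧) (n : ℕ) :
    coeff n (p * expS 𝕜 k a) = ∑ i ∈ Finset.range (n / k + 1),
      (i.factorial : 𝕜)⁻¹ • (coeff (n - k * i) p * a ^ i) := by
  rw [coeff_mul, ← Finset.Nat.sum_antidiagonal_swap]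
  simp only [Prod.fst_swap, Prod.snd_swap]
  rw [sum_antidiagonal_eq_sum_multiples hk n
    (fun i j => coeff j p * coeff i (expS 𝕜 k a)) fun i j h => by simp [expS, h]]
  exact Finset.sum_congr rfl fun i _ => by simp [expS, hk]

/-- The binomial theorem in terms of divided powers. -/
lemma sum_antidiagonal_inv_factorial [CharZero 𝕜] {B : Type*} [Ring B] [Algebra 𝕜 B] {x y : B}
    (h : Commute x y) (s : ℕ) :
    ∑ ij ∈ antidiagonal s,
      ((ij.1.factorial : 𝕜)⁻¹ * (ij.2.factorial : 𝕜)⁻¹) • (x ^ ij.1 * y ^ ij.2) =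
      (s.factorial : 𝕜)⁻¹ • (x + y) ^ s := by
  rw [h.add_pow', Finset.smul_sum]
  refine Finset.sum_congr rfl fun ij hij => ?_
  have hs := mem_antidiagonal.1 hij
  have hc : (s.choose ij.1 : 𝕜) * (ij.1.factorial * ij.2.factorial) = s.factorial := by
    rw [← hs, ← mul_assoc]
    rw [Nat.choose_symm_add]
    exact_mod_cast Nat.add_choose_mul_factorial_mul_factorial ij.1 ij.2
  rw [← Nat.cast_smul_eq_nsmul 𝕜, smul_smul, ← hc]
  congr 1
  have h1 : (ij.1.factorial : 𝕜) ≠ 0 := by exact_mod_cast ij.1.factorial_ne_zero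
  have h2 : (ij.2.factorial : 𝕜) ≠ 0 := by exact_mod_cast ij.2.factorial_ne_zero
  have h3 : (s.choose ij.1 : 𝕜) ≠ 0 := by
    have := Nat.choose_pos (show ij.1 ≤ s by omega)
    exact_mod_cast this.ne'
  field_simp

/-- Summation over `i` and `j` with `k (i + j) ≤ n`, grouped by `s = i + j`. -/
lemma sum_range_div_flip {M : Type*} [AddCommMonoid M] {k : ℕ} (n : ℕ) (f : ℕ → ℕ → M) :
    ∑ i ∈ Finset.range (n / k + 1), ∑ j ∈ Finset.range ((n - k * i) / k + 1), f i j =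
      ∑ s ∈ Finset.range (n / k + 1), ∑ ij ∈ antidiagonal s, f ij.1 ij.2 := by
  simp_rw [Finset.Nat.sum_antidiagonal_eq_sum_range_succ f]
  rw [Finset.sum_range_diag_flip]
  refine Finset.sum_congr rfl fun i hi => ?_
  rw [Nat.sub_mul_div]
  congr 2
  have := Finset.mem_range.1 hi
  omega

lemma expS_add [CharZero 𝕜] {k : ℕ} (hk : 0 < k) {a b : A} (h : Commute a b) :
    expS 𝕜 k (a + b) = expS 𝕜 k a * expS 𝕜 k b := by
  ext n
  rw [coeff_expS_mul 𝕜 hk, expS, coeff_mk]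
  split_ifs with hn
  · obtain ⟨s, rfl⟩ := hn
    rw [Nat.mul_div_cancel_left _ hk, ← sum_antidiagonal_inv_factorial 𝕜 h,
      Finset.Nat.sum_antidiagonal_eq_sum_range_succ (fun i j =>
        ((i.factorial : 𝕜)⁻¹ * (j.factorial : 𝕜)⁻¹) • (a ^ i * b ^ j))]
    refine Finset.sum_congr rfl fun i _ => ?_
    rw [← Nat.mul_sub, expS, coeff_mk, if_pos ⟨_, rfl⟩, Nat.mul_div_cancel_left _ hk,
      mul_smul_comm, smul_smul]
  · refine (Finset.sum_eq_zero fun i hi => ?_).symm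
    rw [expS, coeff_mk, if_neg, mul_zero, smul_zero]
    intro h'
    have h1 : k * i ≤ n := (Nat.mul_le_mul_left k (Nat.lt_succ_iff.1 (Finset.mem_range.1 hi))).trans
      (Nat.mul_div_le n k)
    exact hn ((Nat.dvd_sub_iff_left h1 (dvd_mul_right _ _)).1 h')

lemma coeff_expS_zero (k : ℕ) (a : A) : coeff 0 (expS 𝕜 k a) = 1 := by simp [expS]

lemma expS_zero {k : ℕ} (hk : 0 < k) : expS 𝕜 k (0 : A) = 1 := by
  ext n
  rw [expS, coeff_mk, coeff_one]
  split_ifs with h1 h2 h2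
  · simp [h2]
  · have : n / k ≠ 0 := by
      obtain ⟨s, rfl⟩ := h1
      rw [Nat.mul_div_cancel_left _ hk]
      rintro rfl
      simp at h2
    simp [this]
  · simp [h2] at h1
  · rfl

lemma expS_mul_expS_neg [CharZero 𝕜] {k : ℕ} (hk : 0 < k) (a : A) :
    expS 𝕜 k a * expS 𝕜 k (-a) = 1 := by
  rw [← expS_add 𝕜 hk (Commute.neg_right (Commute.refl a)), add_neg_cancel, expS_zero 𝕜 hk]

lemma expS_neg_mul_expS [CharZero 𝕜] {k : ℕ} (hk : 0 < k) (a : A) :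
    expS 𝕜 k (-a) * expS 𝕜 k a = 1 := by
  rw [← expS_add 𝕜 hk (Commute.neg_left (Commute.refl a)), neg_add_cancel, expS_zero 𝕜 hk]

/-- The degree-`s` part of `e^{ad a} b * e^a = e^a * b`: left multiplication by `a` is the sum of
the commuting maps `ad a` and right multiplication by `a`. -/
lemma sum_antidiagonal_ad_pow [CharZero 𝕜] (a b : A) (s : ℕ) :
    ∑ ij ∈ antidiagonal s, ((ij.1.factorial : 𝕜)⁻¹ * (ij.2.factorial : 𝕜)⁻¹) •
      ((ad 𝕜 a ^ ij.2) b * a ^ ij.1) = (s.factorial : 𝕜)⁻¹ • (a ^ s * b) := by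
  have hc : Commute (LinearMap.mulRight 𝕜 a) (ad 𝕜 a) :=
    ((LinearMap.commute_mulLeft_right a a).symm).sub_right (Commute.refl _)
  have h := congrArg (fun T : Module.End 𝕜 A => T b) (sum_antidiagonal_inv_factorial 𝕜 hc s)
  simpa [ad, LinearMap.sum_apply, LinearMap.pow_mulLeft, LinearMap.pow_mulRight] using h

/-- The identity `e^{λ^k ad a} p = e^{λ^k a} p e^{-λ^k a}`, free of inverses. -/
lemma adExp_mul_expS [CharZero 𝕜] {k : ℕ} (hk : 0 < k) (a : A) (p : A⟦X⟧) :
    adExp 𝕜 k a p * expS 𝕜 k a = expS 𝕜 k a * p := by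
  ext n
  rw [coeff_mul_expS 𝕜 hk, coeff_expS_mul 𝕜 hk]
  simp_rw [adExp, coeff_mk, Finset.sum_mul, Finset.smul_sum]
  rw [sum_range_div_flip n (fun i j => (i.factorial : 𝕜)⁻¹ • (((j.factorial : 𝕜)⁻¹ •
    (ad 𝕜 a ^ j) (coeff (n - k * i - k * j) p)) * a ^ i))]
  refine Finset.sum_congr rfl fun s _ => ?_
  rw [← sum_antidiagonal_ad_pow]
  refine Finset.sum_congr rfl fun ij hij => ?_
  rw [Nat.sub_sub, ← mul_add, mem_antidiagonal.1 hij, smul_mul_assoc, smul_smul]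

lemma mul_expS_eq [CharZero 𝕜] {k : ℕ} (hk : 0 < k) (a : A) (p : A⟦X⟧) :
    p * expS 𝕜 k a = expS 𝕜 k a * adExp 𝕜 k (-a) p := by
  have h := adExp_mul_expS 𝕜 hk (-a) p
  calc p * expS 𝕜 k a = expS 𝕜 k a * (expS 𝕜 k (-a) * p) * expS 𝕜 k a := by
        rw [← mul_assoc, expS_mul_expS_neg 𝕜 hk, one_mul]
    _ = _ := by
        rw [← h, mul_assoc, mul_assoc, expS_neg_mul_expS 𝕜 hk, mul_one]

lemma euler_mul (p q : A⟦X⟧) : euler (p * q) = euler p * q + p * euler q := by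
  ext n
  simp only [euler, map_add, coeff_mk, coeff_mul, Finset.smul_sum, ← Finset.sum_add_distrib]
  refine Finset.sum_congr rfl fun ij hij => ?_
  rw [← mem_antidiagonal.1 hij, add_smul, smul_mul_assoc, mul_smul_comm]

lemma euler_expS [CharZero 𝕜] {k : ℕ} (hk : 0 < k) (a : A) :
    euler (expS 𝕜 k a) = PowerSeries.X ^ k * (PowerSeries.C (k • a) * expS 𝕜 k a) := by
  ext n
  rw [coeff_X_pow_mul', euler, coeff_mk]
  split_ifs with h
  · obtain ⟨m, rfl⟩ := Nat.exists_eq_add_of_le h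
    rw [Nat.add_sub_cancel_left, coeff_C_mul, expS, coeff_mk, coeff_mk]
    simp only [Nat.dvd_add_right (dvd_refl k)]
    split_ifs with hm
    · obtain ⟨s, rfl⟩ := hm
      rw [show k + k * s = k * (s + 1) by ring, Nat.mul_div_cancel_left _ hk,
        Nat.mul_div_cancel_left _ hk, Nat.factorial_succ, pow_succ',
        ← Nat.cast_smul_eq_nsmul 𝕜, ← Nat.cast_smul_eq_nsmul 𝕜, smul_mul_assoc, mul_smul_comm,
        smul_smul, smul_smul]
      congr 1
      have h1 : (s.factorial : 𝕜) ≠ 0 := by exact_mod_cast s.factorial_ne_zero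
      have h2 : (s : 𝕜) + 1 ≠ 0 := by exact_mod_cast s.succ_ne_zero
      push_cast
      field_simp
    · simp
  · rw [expS, coeff_mk]
    split_ifs with hm
    · obtain ⟨s, rfl⟩ := hm
      have : s = 0 := by
        by_contra h0
        exact h (Nat.le_mul_of_pos_right k (Nat.pos_of_ne_zero h0))
      simp [this]
    · simp

lemma reflect_mul (p q : A⟦X⟧) : reflect (p * q) = reflect p * reflect q := by
  ext n
  simp only [reflect, coeff_mk, coeff_mul, Finset.mul_sum]
  refine Finset.sum_congr rfl fun ij hij => ?_
  rw [← mem_antidiagonal.1 hij, pow_add]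
  simp only [mul_assoc]
  congr 1
  rw [← mul_assoc, ← mul_assoc, ((Commute.neg_one_left (coeff ij.1 p)).pow_left ij.2).eq]

lemma reflect_expS {k : ℕ} (hk : Odd k) (a : A) : reflect (expS 𝕜 k a) = expS 𝕜 k (-a) := by
  ext n
  simp only [reflect, expS, coeff_mk]
  split_ifs with h
  · obtain ⟨s, rfl⟩ := h
    rw [Nat.mul_div_cancel_left _ hk.pos, neg_pow a, pow_mul, hk.neg_one_pow, mul_smul_comm]
  · simp

/-! ### Differential equation, reflection symmetry and order of vanishing -/

lemma commute_C_expS (k : ℕ) (a : A) (n : ℕ) :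
    Commute (PowerSeries.C (n • a)) (expS 𝕜 k a) := by
  ext m
  rw [coeff_C_mul, coeff_mul_C, expS, coeff_mk]
  split_ifs
  · exact ((((Commute.refl a).pow_right (m / k)).smul_left n).smul_right _).eq
  · simp

/-- The differential equation `R' = F R - R G`, multiplied by `λ`. -/
def IsSol (R F G : A⟦X⟧) : Prop := euler R = PowerSeries.X * (F * R - R * G)

/-- Multiplying a solution by `e^{λ^k c}` on both sides conjugates the coefficients `F` and `G` by
`e^{λ^k c}` and `e^{-λ^k c}`, then adds the logarithmic derivative `k λ^{k-1} c` of the new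
factors to `F` and subtracts it from `G`. -/
lemma IsSol.conj [CharZero 𝕜] {R F G : A⟦X⟧} (h : IsSol R F G) {k : ℕ} (hk : 0 < k) (c : A) :
    IsSol (expS 𝕜 k c * R * expS 𝕜 k c)
      (PowerSeries.X ^ (k - 1) * PowerSeries.C (k • c) + adExp 𝕜 k c F)
      (adExp 𝕜 k (-c) G - PowerSeries.X ^ (k - 1) * PowerSeries.C (k • c)) := by
  unfold IsSol at h ⊢
  -- Abstracting the factors leaves a ring identity in which only powers of `λ` are central.
  obtain ⟨k, rfl⟩ := Nat.exists_eq_succ_of_ne_zero hk.ne'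
  rw [euler_mul, euler_mul, h, euler_expS 𝕜 hk]
  have hC := (commute_C_expS 𝕜 (k + 1) c (k + 1)).eq
  have hF := adExp_mul_expS 𝕜 hk c F
  have hG := mul_expS_eq 𝕜 hk c G
  simp only [Nat.succ_eq_add_one, Nat.add_sub_cancel] at hC hF hG ⊢
  generalize expS 𝕜 (k + 1) c = E at *
  generalize PowerSeries.C ((k + 1) • c) = K at *
  have hX : ∀ p q : A⟦X⟧, p * (PowerSeries.X * q) = PowerSeries.X * (p * q) := fun p q => by
    rw [← mul_assoc, ← PowerSeries.X_mul, mul_assoc]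
  have hXk : ∀ p q : A⟦X⟧, p * (PowerSeries.X ^ k * q) = PowerSeries.X ^ k * (p * q) :=
    fun p q => by rw [← mul_assoc, ← PowerSeries.X_pow_mul, mul_assoc]
  have hF' : ∀ q, adExp 𝕜 (k + 1) c F * (E * q) = E * (F * q) := fun q => by
    rw [← mul_assoc, hF, mul_assoc]
  rw [pow_succ']
  simp only [mul_assoc, mul_add, add_mul, mul_sub, sub_mul, hX E, hX R, hXk E, hXk R, hF', ← hG,
    ← hC]
  abel

/-- The condition `p = 1 + O(λ^k)`, for `k ≥ 1`. -/
def Flat (k : ℕ) (p : A⟦X⟧) : Prop := coeff 0 p = 1 ∧ ∀ i, 0 < i → i < k → coeff i p = 0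

lemma Flat.coeff_mul_of_le {k : ℕ} {p q : A⟦X⟧} (hp : Flat k p) (hq : Flat k q) {n : ℕ}
    (hn : 0 < n) (hnk : n ≤ k) : coeff n (p * q) = coeff n p + coeff n q := by
  obtain ⟨n, rfl⟩ := Nat.exists_eq_succ_of_ne_zero hn.ne'
  rw [coeff_mul, Finset.Nat.sum_antidiagonal_eq_sum_range_succ
    (fun i j => coeff i p * coeff j q), Finset.sum_range_succ, Finset.sum_range_succ',
    Finset.sum_eq_zero]
  · simp [hp.1, hq.1, add_comm]
  · intro i hi
    have := Finset.mem_range.1 hi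
    rw [hp.2 (i + 1) (by omega) (by omega), zero_mul]

lemma Flat.mul {k : ℕ} {p q : A⟦X⟧} (hp : Flat k p) (hq : Flat k q) : Flat k (p * q) := by
  refine ⟨by simp [coeff_mul, hp.1, hq.1], fun i hi hik => ?_⟩
  rw [hp.coeff_mul_of_le hq hi hik.le, hp.2 i hi hik, hq.2 i hi hik, add_zero]

lemma Flat.succ {k : ℕ} {p : A⟦X⟧} (hp : Flat k p) (h : coeff k p = 0) : Flat (k + 1) p := by
  refine ⟨hp.1, fun i hi hik => ?_⟩
  rcases Nat.lt_succ_iff_lt_or_eq.1 hik with h' | rfl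
  · exact hp.2 i hi h'
  · exact h

lemma Flat.coeff_mul_left {k : ℕ} {p : A⟦X⟧} (hp : Flat k p) (q : A⟦X⟧) {n : ℕ} (hn : n < k) :
    coeff n (q * p) = coeff n q := by
  rw [coeff_mul, Finset.sum_eq_single (n, 0)]
  · simp [hp.1]
  · rintro ⟨i, j⟩ hij hne
    have := mem_antidiagonal.1 hij
    have hj : j ≠ 0 := by
      rintro rfl
      simp_all
    simp only at this
    rw [hp.2 j (by omega) (by omega), mul_zero]
  · intro h
    simp at h

lemma Flat.coeff_mul_right {k : ℕ} {p : A⟦X⟧} (hp : Flat k p) (q : A⟦X⟧) {n : ℕ} (hn : n < k) :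
    coeff n (p * q) = coeff n q := by
  rw [coeff_mul, Finset.sum_eq_single (0, n)]
  · simp [hp.1]
  · rintro ⟨i, j⟩ hij hne
    have := mem_antidiagonal.1 hij
    have hj : i ≠ 0 := by
      rintro rfl
      simp_all
    simp only at this
    rw [hp.2 i (by omega) (by omega), zero_mul]
  · intro h
    simp at h

/-- If `R = 1 + O(λ^{k+1})` solves `R' = F R - R G`, the first possibly nonzero coefficient of
`R - 1` is read off from the right-hand side with `R` replaced by `1`. -/
lemma IsSol.smul_coeff {R F G : A⟦X⟧} (h : IsSol R F G) {k : ℕ} (hR : Flat (k + 1) R) :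
    (k + 1) • coeff (k + 1) R = coeff k F - coeff k G := by
  have h' := congrArg (coeff (k + 1)) h
  rw [coeff_succ_X_mul, map_sub, hR.coeff_mul_left F k.lt_succ_self,
    hR.coeff_mul_right G k.lt_succ_self] at h'
  rw [← h', euler, coeff_mk]

end Formal

/-- If `R(-λ) R(λ) = 1` and `R = 1 + r λ^{2k} + ⋯`, comparing coefficients gives `2 r = 0`. -/
lemma Flat.succ_of_reflect (𝕜 : Type*) {A : Type*} [Field 𝕜] [CharZero 𝕜] [Ring A] [Algebra 𝕜 A]
    {R : A⟦X⟧} {k : ℕ} (hk : 0 < k) (hR : Flat (2 * k) R)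
    (h : reflect R * R = 1) : Flat (2 * k + 1) R := by
  refine hR.succ ?_
  have hR' : Flat (2 * k) (reflect R) :=
    ⟨by simp [reflect, hR.1], fun i hi hik => by rw [reflect, coeff_mk, hR.2 i hi hik, mul_zero]⟩
  have h' := congrArg (coeff (2 * k)) h
  rw [hR'.coeff_mul_of_le hR (by omega) le_rfl, reflect, coeff_mk, coeff_one, if_neg (by omega),
    pow_mul, neg_one_sq, one_pow, one_mul, ← two_smul 𝕜] at h'
  exact (smul_eq_zero_iff_right (two_ne_zero)).1 h'

section Formal

variable (𝕜 : Type*) {A : Type*} [Field 𝕜] [Ring A] [Algebra 𝕜 A]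

lemma flat_expS {k : ℕ} (a : A) : Flat k (expS 𝕜 k a) :=
  ⟨coeff_expS_zero 𝕜 k a, fun i hi hik => by
    rw [expS, coeff_mk, if_neg (Nat.not_dvd_of_pos_of_lt hi hik)]⟩

lemma coeff_expS_self {k : ℕ} (hk : 0 < k) (a : A) : coeff k (expS 𝕜 k a) = a := by
  simp [expS, Nat.div_self hk]

lemma reflect_conj [CharZero 𝕜] {R : A⟦X⟧} (h : reflect R * R = 1) {k : ℕ} (hk : Odd k) (c : A) :
    reflect (expS 𝕜 k c * R * expS 𝕜 k c) * (expS 𝕜 k c * R * expS 𝕜 k c) = 1 := by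
  rw [reflect_mul, reflect_mul, reflect_expS 𝕜 hk]
  calc _ = expS 𝕜 k (-c) * (reflect R * (expS 𝕜 k (-c) * expS 𝕜 k c) * R) * expS 𝕜 k c := by
        simp only [mul_assoc]
    _ = 1 := by
        rw [expS_neg_mul_expS 𝕜 hk.pos, mul_one, h, mul_one, expS_neg_mul_expS 𝕜 hk.pos]

lemma ad_smul (c : 𝕜) (a : A) : ad 𝕜 (c • a) = c • ad 𝕜 a := by
  ext b
  simp [ad, smul_sub]

lemma ad_smul_pow (c : 𝕜) (a b : A) (j : ℕ) :
    (ad 𝕜 (c • a) ^ j) b = c ^ j • (ad 𝕜 a ^ j) b := by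
  rw [ad_smul, smul_pow, LinearMap.smul_apply]

lemma ad_neg_pow (a b : A) (j : ℕ) : (ad 𝕜 (-a) ^ j) b = (-1 : 𝕜) ^ j • (ad 𝕜 a ^ j) b := by
  rw [← ad_smul_pow, neg_one_smul]

lemma coeff_adExp_C (a b : A) (n : ℕ) :
    coeff n (adExp 𝕜 1 a (PowerSeries.C b)) = (n.factorial : 𝕜)⁻¹ • (ad 𝕜 a ^ n) b := by
  rw [adExp, coeff_mk, Nat.div_one, Finset.sum_range_succ, Finset.sum_eq_zero]
  · simp
  · intro j hj
    have := Finset.mem_range.1 hj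
    rw [coeff_C, if_neg (by omega), map_zero, smul_zero]

end Formal

/-! ### The recursion for the exponents -/

section Recursion

variable (𝕜 : Type*) [RCLike 𝕜] {A : Type*} [NormedRing A] [NormedAlgebra 𝕜 A]

lemma adPow_eq (a b : A) (j : ℕ) : adPow a j b = (ad 𝕜 a ^ j) b := by
  rw [adPow, Module.End.pow_apply]
  rfl

lemma mk_fStep (k : ℕ) (hk : 0 < k) (c : A) (f : ℕ → A) :
    PowerSeries.mk (fStep 𝕜 k c f) = PowerSeries.X ^ (k - 1) * PowerSeries.C (k • (-c)) +
      adExp 𝕜 k (-c) (PowerSeries.mk f) := by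
  ext l
  rw [map_add, coeff_mk, fStep, adExp, coeff_mk, coeff_X_pow_mul', coeff_C]
  simp only [adPow_eq 𝕜, ad_neg_pow, coeff_mk, smul_smul]
  split_ifs with h1 h2 h3 h3
  · subst h1
    rw [Nat.div_eq_of_lt (by omega)]
    simp [← Nat.cast_smul_eq_nsmul 𝕜]
  · omega
  · omega
  · omega
  · rw [zero_add]
    refine Finset.sum_congr rfl fun j _ => ?_
    rw [div_eq_inv_mul]
  · rw [zero_add]
    refine Finset.sum_congr rfl fun j _ => ?_
    rw [div_eq_inv_mul]

lemma mk_gStep (k : ℕ) (hk : 0 < k) (c : A) (g : ℕ → A) :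
    PowerSeries.mk (gStep 𝕜 k c g) = adExp 𝕜 k (- -c) (PowerSeries.mk g) -
      PowerSeries.X ^ (k - 1) * PowerSeries.C (k • (-c)) := by
  ext l
  rw [map_sub, coeff_mk, gStep, adExp, coeff_mk, coeff_X_pow_mul', coeff_C, neg_neg]
  simp only [adPow_eq 𝕜, coeff_mk]
  split_ifs with h1 h2 h3 h3
  · subst h1
    rw [Nat.div_eq_of_lt (by omega)]
    simp [← Nat.cast_smul_eq_nsmul 𝕜, add_comm]
  · omega
  · omega
  · omega
  · simp
  · simp

/-- The coefficients of `-X/2 + e^{-λ ad X / 2} (X + Y)`; since `ad X` kills `X`, this is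
`X/2 + e^{-λ ad X / 2} Y`. -/
lemma coeff_conj_add (X Y : A) (n : ℕ) :
    coeff n (PowerSeries.C (-((1 / 2 : 𝕜) • X)) + adExp 𝕜 1 (-((1 / 2 : 𝕜) • X))
      (PowerSeries.C (X + Y))) = coeff n (PowerSeries.C ((1 / 2 : 𝕜) • X)) +
      ((n.factorial : 𝕜)⁻¹ * (-1 / 2) ^ n) • (ad 𝕜 X ^ n) Y := by
  rw [map_add, coeff_adExp_C, ← neg_smul, ad_smul_pow, smul_smul, neg_div, map_add (ad 𝕜 X ^ n),
    smul_add, ← add_assoc]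
  congr 1
  rcases n with _ | n
  · simp only [coeff_zero_C, Nat.factorial_zero, pow_zero, Module.End.one_apply]
    module
  · have : (ad 𝕜 X ^ (n + 1)) X = 0 := by
      rw [pow_succ, Module.End.mul_apply]
      simp [ad]
    simp [this]

/-- The series `F₁` is `-Y/2 + e^{-λ ad Y / 2} (-X/2 + e^{-λ ad X / 2} (X + Y))`. -/
lemma mk_fInit (X Y : A) :
    PowerSeries.mk (fInit 𝕜 X Y) = PowerSeries.C (-((1 / 2 : 𝕜) • Y)) +
      adExp 𝕜 1 (-((1 / 2 : 𝕜) • Y)) (PowerSeries.C (-((1 / 2 : 𝕜) • X)) +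
        adExp 𝕜 1 (-((1 / 2 : 𝕜) • X)) (PowerSeries.C (X + Y))) := by
  ext l
  rw [map_add, coeff_mk, adExp, coeff_mk, Nat.div_one]
  simp only [coeff_conj_add, one_mul]
  simp only [map_add, smul_add, Finset.sum_add_distrib]
  have h1 : ∑ j ∈ Finset.range (l + 1), (j.factorial : 𝕜)⁻¹ •
      (ad 𝕜 (-((1 / 2 : 𝕜) • Y)) ^ j) (coeff (l - j) (PowerSeries.C ((1 / 2 : 𝕜) • X))) =
      ((-1) ^ l / 2 ^ l : 𝕜) • (1 / (2 * (l.factorial : 𝕜))) • adPow Y l X := by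
    rw [Finset.sum_range_succ, Finset.sum_eq_zero, zero_add, Nat.sub_self, coeff_zero_C,
      ← neg_smul, ad_smul_pow, adPow_eq 𝕜, map_smul (ad 𝕜 Y ^ l), smul_smul, smul_smul, smul_smul]
    · congr 1
      rw [neg_div', div_pow]
      have : (l.factorial : 𝕜) ≠ 0 := by exact_mod_cast l.factorial_ne_zero
      field_simp
    · intro j hj
      have := Finset.mem_range.1 hj
      rw [coeff_C, if_neg (by omega), map_zero, smul_zero]
  have h2 : ∑ j ∈ Finset.range (l + 1), (j.factorial : 𝕜)⁻¹ •
      (ad 𝕜 (-((1 / 2 : 𝕜) • Y)) ^ j)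
        ((((l - j).factorial : 𝕜)⁻¹ * (-1 / 2) ^ (l - j)) • (ad 𝕜 X ^ (l - j)) Y) =
      ((-1) ^ l / 2 ^ l : 𝕜) • ∑ j ∈ Finset.range (l + 1),
        (1 / ((j.factorial : 𝕜) * ((l - j).factorial : 𝕜))) • adPow Y (l - j) (adPow X j Y) := by
    rw [← Finset.sum_flip, Finset.smul_sum]
    refine Finset.sum_congr rfl fun j hj => ?_
    have hjl : j ≤ l := Nat.lt_succ_iff.1 (Finset.mem_range.1 hj)
    rw [Nat.sub_sub_self hjl, ← neg_smul, ad_smul_pow, adPow_eq 𝕜, adPow_eq 𝕜,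
      map_smul (ad 𝕜 Y ^ (l - j)), smul_smul, smul_smul, smul_smul]
    congr 1
    rw [← div_pow, neg_div', ← Nat.sub_add_cancel hjl, pow_add, Nat.sub_add_cancel hjl]
    field_simp
  rw [h1, h2, fInit]
  split_ifs with h
  · subst h
    simp [adPow]
    module
  · rw [coeff_C, if_neg h, zero_add, smul_add]

/-- The series `G₁` is `Y/2 + e^{λ ad Y / 2} (X/2)`. -/
lemma mk_gInit (X Y : A) :
    PowerSeries.mk (gInit 𝕜 X Y) = PowerSeries.C ((1 / 2 : 𝕜) • Y) +
      adExp 𝕜 1 ((1 / 2 : 𝕜) • Y) (PowerSeries.C ((1 / 2 : 𝕜) • X)) := by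
  ext l
  rw [map_add, coeff_mk, coeff_adExp_C, gInit, ad_smul_pow, adPow_eq 𝕜, map_smul (ad 𝕜 Y ^ l),
    coeff_C]
  split_ifs with h
  · subst h
    simp [add_comm]
  · rw [zero_add, smul_smul, smul_smul]
    congr 1
    have : (l.factorial : 𝕜) ≠ 0 := by exact_mod_cast l.factorial_ne_zero
    rw [pow_succ, div_pow, one_pow]
    field_simp

/-! ### The residual factors -/

/-- The series `R_k`, `k = 2m + 1`: what remains of `e^{λ(X+Y)}` once the factors of the symmetric
product up to degree `k` have been removed on both sides. -/
def residual (X Y : A) : ℕ → A⟦X⟧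
  | 0 => expS 𝕜 1 (-((1 / 2 : 𝕜) • Y)) * (expS 𝕜 1 (-((1 / 2 : 𝕜) • X)) * expS 𝕜 1 (X + Y) *
      expS 𝕜 1 (-((1 / 2 : 𝕜) • X))) * expS 𝕜 1 (-((1 / 2 : 𝕜) • Y))
  | m + 1 => expS 𝕜 (2 * m + 3) (-exponent 𝕜 X Y (2 * m + 3)) * residual X Y m *
      expS 𝕜 (2 * m + 3) (-exponent 𝕜 X Y (2 * m + 3))

lemma exponent_odd (X Y : A) (m : ℕ) : exponent 𝕜 X Y (2 * m + 3) =
    nextExponent 𝕜 (2 * m + 3) (fg 𝕜 X Y m).1 (fg 𝕜 X Y m).2 := by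
  rw [exponent, if_pos ⟨by omega, m + 1, by ring⟩, show (2 * m + 3 - 3) / 2 = m by omega]

lemma exponent_even (X Y : A) {k : ℕ} (hk : Even k) : exponent 𝕜 X Y k = 0 :=
  if_neg fun h => (Nat.not_odd_iff_even.2 hk) h.2

lemma isSol_residual (X Y : A) (m : ℕ) : IsSol (residual 𝕜 X Y m)
    (PowerSeries.mk (fg 𝕜 X Y m).1) (PowerSeries.mk (fg 𝕜 X Y m).2) := by
  induction m with
  | zero =>
    -- The choice `F = X + Y`, `G = 0` for `e^{λ(X+Y)}` is the one that leads to `fInit`, `gInit`.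
    have h0 : IsSol (expS 𝕜 1 (X + Y)) (PowerSeries.C (X + Y)) 0 := by
      simp [IsSol, euler_expS]
    have h := (h0.conj 𝕜 one_pos (-((1 / 2 : 𝕜) • X))).conj 𝕜 one_pos (-((1 / 2 : 𝕜) • Y))
    have hz : ∀ a : A, adExp 𝕜 1 a 0 = 0 := fun a => by
      ext n
      simp [adExp]
    simp only [Nat.sub_self, pow_zero, one_mul, one_smul, hz, zero_sub, neg_neg] at h
    simp only [← map_neg, neg_neg] at h
    rw [sub_eq_add_neg, ← map_neg, neg_neg, add_comm (adExp _ _ _ _), ← mk_gInit, ← mk_fInit] at h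
    exact h
  | succ m ih =>
    have h := ih.conj 𝕜 (show 0 < 2 * m + 3 by omega) (-exponent 𝕜 X Y (2 * m + 3))
    rw [← mk_fStep 𝕜 _ (by omega), ← mk_gStep 𝕜 _ (by omega), exponent_odd] at h
    rw [residual, exponent_odd]
    exact h

lemma reflect_residual_mul (X Y : A) (m : ℕ) :
    reflect (residual 𝕜 X Y m) * residual 𝕜 X Y m = 1 := by
  induction m with
  | zero =>
    refine reflect_conj 𝕜 (reflect_conj 𝕜 ?_ odd_one _) odd_one _
    rw [reflect_expS 𝕜 odd_one, expS_neg_mul_expS 𝕜 one_pos]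
  | succ m ih => exact reflect_conj 𝕜 ih ⟨m + 1, by ring⟩ _

lemma flat_residual (X Y : A) (m : ℕ) : Flat (2 * m + 3) (residual 𝕜 X Y m) := by
  induction m with
  | zero =>
    -- The coefficient of `λ` vanishes as `f_{1,0} = g_{1,0}`.
    have h1 : Flat 1 (residual 𝕜 X Y 0) :=
      ((flat_expS 𝕜 _).mul (((flat_expS 𝕜 _).mul (flat_expS 𝕜 _)).mul (flat_expS 𝕜 _))).mul
        (flat_expS 𝕜 _)
    have h2 := (isSol_residual 𝕜 X Y 0).smul_coeff (k := 0) h1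
    simp only [zero_add, one_smul, fg, coeff_mk, fInit, gInit, if_true, sub_self] at h2
    exact Flat.succ_of_reflect 𝕜 one_pos (h1.succ h2) (reflect_residual_mul 𝕜 X Y 0)
  | succ m ih =>
    have h1 := (isSol_residual 𝕜 X Y m).smul_coeff (k := 2 * m + 2) ih
    have hE := flat_expS 𝕜 (k := 2 * m + 3) (-exponent 𝕜 X Y (2 * m + 3))
    have hR := hE.mul ih
    -- With `k = 2m + 3`, this coefficient is that of `R_{k-2}`, namely `2 C_k`, minus `2 C_k`.
    have h2 : coeff (2 * m + 3) (residual 𝕜 X Y (m + 1)) = 0 := by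
      rw [residual, hR.coeff_mul_of_le hE (by omega) le_rfl,
        hE.coeff_mul_of_le ih (by omega) le_rfl, coeff_expS_self 𝕜 (by omega), exponent_odd,
        nextExponent]
      simp only [coeff_mk] at h1
      rw [show 2 * m + 3 - 1 = 2 * m + 2 by omega, ← h1, ← Nat.cast_smul_eq_nsmul 𝕜, smul_smul]
      have : ((2 * m + 3 : ℕ) : 𝕜) ≠ 0 := by exact_mod_cast (by omega : 2 * m + 3 ≠ 0)
      rw [show 1 / (2 * ((2 * m + 3 : ℕ) : 𝕜)) * ((2 * m + 2 + 1 : ℕ) : 𝕜) = 1 / 2 by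
        rw [show 2 * m + 2 + 1 = 2 * m + 3 by ring]
        field_simp]
      module
    have h3 : Flat (2 * m + 4) (residual 𝕜 X Y (m + 1)) := (hR.mul hE).succ h2
    exact Flat.succ_of_reflect 𝕜 (k := m + 2) (by omega) h3 (reflect_residual_mul 𝕜 X Y (m + 1))

/-- The formal series of the left half of `Ψ_{n+1}`; the degrees of its factors run up to
`n + 1`. -/
def leftS (X Y : A) (n : ℕ) : A⟦X⟧ :=
  expS 𝕜 1 ((1 / 2 : 𝕜) • X) * expS 𝕜 1 ((1 / 2 : 𝕜) • Y) *
    ((List.range' 2 n).map fun j => expS 𝕜 j (exponent 𝕜 X Y j)).prod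

/-- The formal series of the right half of `Ψ_{n+1}`. -/
def rightS (X Y : A) (n : ℕ) : A⟦X⟧ :=
  ((List.range' 2 n).map fun j => expS 𝕜 j (exponent 𝕜 X Y j)).reverse.prod *
    expS 𝕜 1 ((1 / 2 : 𝕜) • Y) * expS 𝕜 1 ((1 / 2 : 𝕜) • X)

lemma leftS_succ (X Y : A) (n : ℕ) :
    leftS 𝕜 X Y (n + 1) = leftS 𝕜 X Y n * expS 𝕜 (n + 2) (exponent 𝕜 X Y (n + 2)) := by
  rw [leftS, leftS, List.range'_1_concat, List.map_append, List.prod_append, add_comm 2 n]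
  simp [mul_assoc]

lemma rightS_succ (X Y : A) (n : ℕ) :
    rightS 𝕜 X Y (n + 1) = expS 𝕜 (n + 2) (exponent 𝕜 X Y (n + 2)) * rightS 𝕜 X Y n := by
  rw [rightS, rightS, List.range'_1_concat, List.map_append, List.reverse_append,
    List.prod_append, add_comm 2 n]
  simp [mul_assoc]

lemma leftS_mul_residual_mul_rightS (X Y : A) (n : ℕ) :
    leftS 𝕜 X Y n * residual 𝕜 X Y (n / 2) * rightS 𝕜 X Y n = expS 𝕜 1 (X + Y) := by
  induction n with
  | zero =>
    simp only [leftS, rightS, residual, List.range'_zero, List.map_nil, List.prod_nil,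
      List.reverse_nil, mul_one, one_mul, Nat.zero_div]
    have hX1 := expS_mul_expS_neg 𝕜 one_pos ((1 / 2 : 𝕜) • X)
    have hX2 := expS_neg_mul_expS 𝕜 one_pos ((1 / 2 : 𝕜) • X)
    have hY1 := expS_mul_expS_neg 𝕜 one_pos ((1 / 2 : 𝕜) • Y)
    have hY2 := expS_neg_mul_expS 𝕜 one_pos ((1 / 2 : 𝕜) • Y)
    generalize expS 𝕜 1 ((1 / 2 : 𝕜) • X) = U at *
    generalize expS 𝕜 1 (-((1 / 2 : 𝕜) • X)) = U' at *
    generalize expS 𝕜 1 ((1 / 2 : 𝕜) • Y) = V at *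
    generalize expS 𝕜 1 (-((1 / 2 : 𝕜) • Y)) = V' at *
    calc U * V * (V' * (U' * expS 𝕜 1 (X + Y) * U') * V') * (V * U)
        = U * (V * V') * U' * expS 𝕜 1 (X + Y) * (U' * (V' * V) * U) := by
          simp only [mul_assoc]
      _ = _ := by rw [hY1, hY2, mul_one, mul_one, hX1, hX2, one_mul, mul_one]
  | succ n ih =>
    rw [leftS_succ, rightS_succ]
    rcases Nat.even_or_odd' n with ⟨m, rfl | rfl⟩
    -- Factors of even degree are `1`.
    · rw [exponent_even 𝕜 X Y ⟨m + 1, by ring⟩, expS_zero 𝕜 (by omega), mul_one, one_mul,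
        show (2 * m + 1) / 2 = 2 * m / 2 by omega]
      exact ih
    · rw [show (2 * m + 1 + 1) / 2 = m + 1 by omega, residual]
      rw [show (2 * m + 1) / 2 = m by omega] at ih
      rw [← ih, show 2 * m + 1 + 2 = 2 * m + 3 by ring]
      have h1 := expS_mul_expS_neg 𝕜 (show 0 < 2 * m + 3 by omega) (exponent 𝕜 X Y (2 * m + 3))
      have h2 := expS_neg_mul_expS 𝕜 (show 0 < 2 * m + 3 by omega) (exponent 𝕜 X Y (2 * m + 3))
      generalize expS 𝕜 (2 * m + 3) (exponent 𝕜 X Y (2 * m + 3)) = E at *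
      generalize expS 𝕜 (2 * m + 3) (-exponent 𝕜 X Y (2 * m + 3)) = E' at *
      calc leftS 𝕜 X Y (2 * m + 1) * E * (E' * residual 𝕜 X Y m * E') *
            (E * rightS 𝕜 X Y (2 * m + 1))
          = leftS 𝕜 X Y (2 * m + 1) * (E * E') * residual 𝕜 X Y m * (E' * E) *
            rightS 𝕜 X Y (2 * m + 1) := by simp only [mul_assoc]
        _ = _ := by rw [h1, h2, mul_one, mul_one]

/-- The series of `Ψ_{n+1}` and of `e^{λ(X+Y)}` agree up to order `n + 1`, because the residual
factor between the two halves is `1 + O(λ^{n+2})`. -/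
lemma coeff_leftS_mul_rightS (X Y : A) {n i : ℕ} (hi : i < n + 2) :
    coeff i (leftS 𝕜 X Y n * rightS 𝕜 X Y n) = coeff i (expS 𝕜 1 (X + Y)) := by
  rw [← leftS_mul_residual_mul_rightS 𝕜 X Y n, coeff_mul, coeff_mul]
  refine Finset.sum_congr rfl fun jk hjk => ?_
  have := mem_antidiagonal.1 hjk
  rw [(flat_residual 𝕜 X Y (n / 2)).coeff_mul_left _ (by omega)]

end Recursion

/-! ### Weighted norms, evaluation and convergence -/

section Analytic

/-- The weighted `ℓ¹` norm `∑ ‖p_n‖ r^n`, with values in `[0, ∞]`. -/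
def wnorm {A : Type*} [NormedRing A] (r : ℝ≥0) (p : A⟦X⟧) : ℝ≥0∞ :=
  ∑' n, ‖coeff n p‖ₑ * (r : ℝ≥0∞) ^ n

/-- The bound `1 + ‖p - 1‖_r ≤ e^a` for the weighted norm `wnorm r`. It is multiplicative in `p`,
additive in `a`, and does not involve `‖1‖`, which need not be `1`. -/
def ExpBound {A : Type*} [NormedRing A] (r : ℝ≥0) (p : A⟦X⟧) (a : ℝ) : Prop :=
  1 + wnorm r (p - 1) ≤ ENNReal.ofReal (Real.exp a)

/-- The series `p` converges absolutely at `z`, with sum `a`. -/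
def Evals {𝕜 : Type*} [RCLike 𝕜] {A : Type*} [NormedRing A] [NormedAlgebra 𝕜 A]
    (z : 𝕜) (p : A⟦X⟧) (a : A) : Prop :=
  Summable (fun n => ‖z ^ n • coeff n p‖) ∧ HasSum (fun n => z ^ n • coeff n p) a

section

variable {A : Type*} [NormedRing A]

lemma wnorm_add_le (r : ℝ≥0) (p q : A⟦X⟧) : wnorm r (p + q) ≤ wnorm r p + wnorm r q := by
  rw [wnorm, wnorm, wnorm, ← ENNReal.tsum_add]
  refine ENNReal.tsum_le_tsum fun n => ?_
  rw [map_add, ← add_mul]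
  gcongr
  exact enorm_add_le _ _

lemma wnorm_neg (r : ℝ≥0) (p : A⟦X⟧) : wnorm r (-p) = wnorm r p := by
  simp [wnorm]

lemma wnorm_mul_le (r : ℝ≥0) (p q : A⟦X⟧) : wnorm r (p * q) ≤ wnorm r p * wnorm r q := by
  calc wnorm r (p * q)
      ≤ ∑' n, ∑ ij ∈ antidiagonal n,
        (‖coeff ij.1 p‖ₑ * (r : ℝ≥0∞) ^ ij.1) * (‖coeff ij.2 q‖ₑ * (r : ℝ≥0∞) ^ ij.2) := by
        refine ENNReal.tsum_le_tsum fun n => ?_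
        rw [coeff_mul]
        calc _ ≤ (∑ ij ∈ antidiagonal n, ‖coeff ij.1 p * coeff ij.2 q‖ₑ) * (r : ℝ≥0∞) ^ n := by
              gcongr
              exact enorm_sum_le _ _
          _ ≤ _ := by
              rw [Finset.sum_mul]
              refine Finset.sum_le_sum fun ij hij => ?_
              have hn : ij.1 + ij.2 = n := mem_antidiagonal.1 hij
              rw [← hn, pow_add, mul_mul_mul_comm]
              gcongr
              simp only [enorm_eq_nnnorm]
              exact_mod_cast nnnorm_mul_le _ _
    _ = ∑' x : ℕ × ℕ,
        (‖coeff x.1 p‖ₑ * (r : ℝ≥0∞) ^ x.1) * (‖coeff x.2 q‖ₑ * (r : ℝ≥0∞) ^ x.2) := by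
        rw [← Finset.HasAntidiagonal.sigmaAntidiagonalEquivProd.tsum_eq, ENNReal.tsum_sigma']
        refine tsum_congr fun n => ?_
        rw [tsum_fintype, ← Finset.sum_coe_sort]
        rfl
    _ = _ := by
        rw [ENNReal.tsum_prod']
        simp_rw [ENNReal.tsum_mul_left, ENNReal.tsum_mul_right]
        rfl

lemma ExpBound.mul {r : ℝ≥0} {p q : A⟦X⟧} {a b : ℝ} (hp : ExpBound r p a)
    (hq : ExpBound r q b) : ExpBound r (p * q) (a + b) := by
  unfold ExpBound at *
  calc 1 + wnorm r (p * q - 1)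
      = 1 + wnorm r ((p - 1) * (q - 1) + ((p - 1) + (q - 1))) := by
        congr 2
        noncomm_ring
    _ ≤ 1 + (wnorm r (p - 1) * wnorm r (q - 1) + (wnorm r (p - 1) + wnorm r (q - 1))) := by
        gcongr
        refine (wnorm_add_le _ _ _).trans ?_
        gcongr
        · exact wnorm_mul_le _ _ _
        · exact wnorm_add_le _ _ _
    _ = (1 + wnorm r (p - 1)) * (1 + wnorm r (q - 1)) := by ring
    _ ≤ ENNReal.ofReal (Real.exp a) * ENNReal.ofReal (Real.exp b) := by gcongr
    _ = _ := by rw [← ENNReal.ofReal_mul (Real.exp_nonneg _), Real.exp_add]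

lemma ExpBound.mono {r : ℝ≥0} {p : A⟦X⟧} {a b : ℝ} (hp : ExpBound r p a) (h : a ≤ b) :
    ExpBound r p b :=
  le_trans hp (ENNReal.ofReal_le_ofReal (Real.exp_le_exp.2 h))

lemma ExpBound.wnorm_le {r : ℝ≥0} {p : A⟦X⟧} {a : ℝ} (hp : ExpBound r p a) :
    wnorm r (p - 1) ≤ ENNReal.ofReal (Real.exp a) :=
  le_add_self.trans hp

end

variable {𝕜 : Type*} [RCLike 𝕜] {A : Type*} [NormedRing A] [NormedAlgebra 𝕜 A]

variable (𝕜) in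
lemma expBound_expS (r : ℝ≥0) {k : ℕ} (hk : 0 < k) (a : A) :
    ExpBound r (expS 𝕜 k a) (‖a‖ * r ^ k) := by
  have h0 : coeff 0 (expS 𝕜 k a - 1) = 0 := by
    rw [map_sub, coeff_expS_zero, coeff_zero_one, sub_self]
  have h1 : wnorm r (expS 𝕜 k a - 1) =
      ∑' i, ‖coeff (k * i) (expS 𝕜 k a - 1)‖ₑ * (r : ℝ≥0∞) ^ (k * i) := by
    refine (Function.Injective.tsum_eq (mul_right_injective₀ hk.ne')
      (f := fun n => ‖coeff n (expS 𝕜 k a - 1)‖ₑ * (r : ℝ≥0∞) ^ n) fun n hn => ?_).symm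
    by_contra hr
    refine hn ?_
    have hkn : ¬ k ∣ n := fun ⟨i, hi⟩ => hr ⟨i, hi.symm⟩
    have hn0 : n ≠ 0 := by
      rintro rfl
      exact hkn (dvd_zero k)
    simp [expS, hkn, coeff_one, hn0]
  have hs := NormedSpace.expSeries_div_hasSum_exp (‖a‖ * r ^ k)
  rw [← Real.exp_eq_exp_ℝ] at hs
  rw [ExpBound, h1, ← hs.tsum_eq, ENNReal.ofReal_tsum_of_nonneg (fun n => by positivity)
    hs.summable, ← tsum_ite_eq 0 (fun _ => (1 : ℝ≥0∞)), ← ENNReal.tsum_add]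
  refine ENNReal.tsum_le_tsum fun i => ?_
  rcases i with _ | i
  · simp [h0]
  · rw [if_neg (by omega), zero_add, map_sub, coeff_one, if_neg (by positivity), sub_zero, expS,
      coeff_mk, if_pos ⟨_, rfl⟩, Nat.mul_div_cancel_left _ hk, ← ofReal_norm,
      ← ENNReal.ofReal_coe_nnreal, ← ENNReal.ofReal_pow r.coe_nonneg,
      ← ENNReal.ofReal_mul (norm_nonneg _)]
    refine ENNReal.ofReal_le_ofReal ?_
    calc _ ≤ (((i + 1).factorial : ℝ)⁻¹ * ‖a‖ ^ (i + 1)) * (r : ℝ) ^ (k * (i + 1)) := by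
          gcongr
          refine (norm_smul_le _ _).trans ?_
          rw [norm_inv, RCLike.norm_natCast]
          gcongr
          exact norm_pow_le' a i.succ_pos
      _ = _ := by
          rw [mul_pow, ← pow_mul, div_eq_inv_mul, mul_assoc]

lemma Evals.one (z : 𝕜) : Evals z (1 : A⟦X⟧) 1 := by
  have h : ∀ n ∉ ({0} : Finset ℕ), z ^ n • coeff n (1 : A⟦X⟧) = 0 := fun n hn => by
    rw [coeff_one, if_neg (by simpa using hn), smul_zero]
  refine ⟨summable_of_ne_finset_zero (s := {0}) fun n hn => by rw [h n hn, norm_zero], ?_⟩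
  simpa using hasSum_sum_of_ne_finset_zero h

lemma Evals.mul [CompleteSpace A] {z : 𝕜} {p q : A⟦X⟧} {a b : A} (hp : Evals z p a)
    (hq : Evals z q b) : Evals z (p * q) (a * b) := by
  have h : ∀ n, z ^ n • coeff n (p * q) = ∑ ij ∈ antidiagonal n,
      (z ^ ij.1 • coeff ij.1 p) * (z ^ ij.2 • coeff ij.2 q) := fun n => by
    rw [coeff_mul, Finset.smul_sum]
    refine Finset.sum_congr rfl fun ij hij => ?_
    rw [← mem_antidiagonal.1 hij, smul_mul_smul_comm, pow_add]
  have hs := summable_norm_sum_mul_antidiagonal_of_summable_norm hp.1 hq.1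
  refine ⟨by simpa only [h] using hs, ?_⟩
  simp only [h]
  rw [← hp.2.tsum_eq, ← hq.2.tsum_eq,
    tsum_mul_tsum_eq_tsum_sum_antidiagonal_of_summable_norm hp.1 hq.1]
  exact hs.of_norm.hasSum

lemma evals_expS [CompleteSpace A] (z : 𝕜) {k : ℕ} (hk : 0 < k) (a : A) :
    Evals z (expS 𝕜 k a) (NormedSpace.exp (z ^ k • a)) := by
  have hf : (fun n => z ^ n • coeff n (expS 𝕜 k a)) ∘ (fun i => k * i) =
      fun i => (i.factorial : 𝕜)⁻¹ • (z ^ k • a) ^ i := by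
    ext i
    simp only [Function.comp, expS, coeff_mk, dvd_mul_right, if_true,
      Nat.mul_div_cancel_left _ hk, smul_pow, pow_mul]
    rw [smul_comm]
  have h0 : ∀ n ∉ Set.range (fun i => k * i),
      z ^ n • coeff n (expS 𝕜 k a) = 0 := fun n hn => by
    rw [expS, coeff_mk, if_neg fun ⟨i, hi⟩ => hn ⟨i, hi.symm⟩, smul_zero]
  have hinj : Function.Injective (fun i => k * i) := mul_right_injective₀ hk.ne'
  constructor
  · rw [← hinj.summable_iff fun n hn => by rw [h0 n hn, norm_zero]]
    exact (summable_congr fun i => congrArg norm (congrFun hf i)).2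
      (NormedSpace.norm_expSeries_summable' (z ^ k • a))
  · rw [← hinj.hasSum_iff h0, hf]
    exact NormedSpace.exp_series_hasSum_exp' (z ^ k • a)

lemma Evals.list_prod [CompleteSpace A] {z : 𝕜} {ι : Type*} (P : ι → A⟦X⟧) (a : ι → A)
    (l : List ι) (h : ∀ i ∈ l, Evals z (P i) (a i)) :
    Evals z (l.map P).prod (l.map a).prod := by
  induction l with
  | nil => simpa using Evals.one z
  | cons i l ih =>
    simp only [List.map_cons, List.prod_cons]
    exact (h i (by simp)).mul (ih fun j hj => h j (by simp [hj]))

lemma evals_psi [CompleteSpace A] (X Y : A) (n : ℕ) (z : 𝕜) :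
    Evals z (leftS 𝕜 X Y n * rightS 𝕜 X Y n) (Psi 𝕜 X Y (n + 1) z) := by
  have hX : ∀ W : A, Evals z (expS 𝕜 1 ((1 / 2 : 𝕜) • W)) (NormedSpace.exp ((z / 2) • W)) := by
    intro W
    have := evals_expS z one_pos ((1 / 2 : 𝕜) • W)
    rwa [pow_one, smul_smul, mul_one_div] at this
  have hl : ∀ l : List ℕ, (∀ j ∈ l, 2 ≤ j) →
      Evals z (l.map fun j => expS 𝕜 j (exponent 𝕜 X Y j)).prod
        (l.map fun j => NormedSpace.exp (z ^ j • exponent 𝕜 X Y j)).prod := fun l h =>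
    Evals.list_prod _ _ l fun j hj => evals_expS z (by have := h j hj; omega) _
  have hr : ∀ j ∈ List.range' 2 n, 2 ≤ j := fun j hj => (List.mem_range'_1.1 hj).1
  rw [Psi, factors, Nat.add_sub_cancel, leftS, rightS, ← List.map_reverse, ← List.map_reverse]
  exact (((hX X).mul (hX Y)).mul (hl _ hr)).mul
    (((hl _ fun j hj => hr j (List.mem_reverse.1 hj)).mul (hX Y)).mul (hX X))

/-- A series without terms below degree `N` is smaller by a factor `q ^ N` on the disc of radius
`q r` than its weighted norm for the radius `r`. -/
lemma enorm_le_of_coeff_eq_zero {z : 𝕜} {p : A⟦X⟧} {a : A}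
    (ha : HasSum (fun n => z ^ n • coeff n p) a) {N : ℕ} (hN : ∀ i < N, coeff i p = 0)
    {q r : ℝ≥0} (hq : q ≤ 1) (hz : ‖z‖₊ ≤ q * r) :
    ‖a‖ₑ ≤ (q : ℝ≥0∞) ^ N * wnorm r p := by
  rw [← ha.tsum_eq, wnorm, ← ENNReal.tsum_mul_left]
  refine enorm_tsum_le_tsum_enorm.trans (ENNReal.tsum_le_tsum fun n => ?_)
  rcases lt_or_ge n N with h | h
  · simp [hN n h]
  · rw [enorm_smul, enorm_pow, mul_left_comm, mul_comm]
    gcongr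
    calc ‖z‖ₑ ^ n ≤ ((q : ℝ≥0∞) * r) ^ n := by
          gcongr
          exact_mod_cast hz
      _ = (q : ℝ≥0∞) ^ n * (r : ℝ≥0∞) ^ n := mul_pow _ _ _
      _ ≤ _ := by
          gcongr ?_ * _
          exact pow_le_pow_right_of_le_one' (by exact_mod_cast hq) h

variable (𝕜) in
lemma expBound_leftS (X Y : A) (r : ℝ≥0) (n : ℕ) : ExpBound r (leftS 𝕜 X Y n)
    ((∑ j ∈ Finset.range (n + 2), majorantCoeff 𝕜 X Y j * (r : ℝ) ^ j) / 2) := by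
  induction n with
  | zero =>
    have h := (expBound_expS 𝕜 r one_pos ((1 / 2 : 𝕜) • X)).mul
      (expBound_expS 𝕜 r one_pos ((1 / 2 : 𝕜) • Y))
    simp only [leftS, List.range'_zero, List.map_nil, List.prod_nil, mul_one]
    refine h.mono (le_of_eq ?_)
    simp [Finset.sum_range_succ, majorantCoeff, norm_smul]
    ring
  | succ n ih =>
    rw [leftS_succ, Finset.sum_range_succ]
    refine (ih.mul (expBound_expS 𝕜 r (by omega) _)).mono (le_of_eq ?_)
    rw [majorantCoeff, if_neg (by omega), if_neg (by omega)]
    ring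

variable (𝕜) in
lemma expBound_rightS (X Y : A) (r : ℝ≥0) (n : ℕ) : ExpBound r (rightS 𝕜 X Y n)
    ((∑ j ∈ Finset.range (n + 2), majorantCoeff 𝕜 X Y j * (r : ℝ) ^ j) / 2) := by
  induction n with
  | zero =>
    have h := (expBound_expS 𝕜 r one_pos ((1 / 2 : 𝕜) • Y)).mul
      (expBound_expS 𝕜 r one_pos ((1 / 2 : 𝕜) • X))
    simp only [rightS, List.range'_zero, List.map_nil, List.reverse_nil, List.prod_nil, one_mul]
    refine h.mono (le_of_eq ?_)
    simp [Finset.sum_range_succ, majorantCoeff, norm_smul]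
    ring
  | succ n ih =>
    rw [rightS_succ, Finset.sum_range_succ]
    refine ((expBound_expS 𝕜 r (by omega) _).mul ih).mono (le_of_eq ?_)
    rw [majorantCoeff, if_neg (by omega), if_neg (by omega)]
    ring

variable (𝕜) in
lemma majorantCoeff_nonneg (X Y : A) (j : ℕ) : 0 ≤ majorantCoeff 𝕜 X Y j := by
  unfold majorantCoeff
  split_ifs <;> positivity

variable (𝕜) in
lemma summable_majorantCoeff (X Y : A) {r : ℝ≥0} (hr : r < rz 𝕜 X Y) :
    Summable fun j => majorantCoeff 𝕜 X Y j * (r : ℝ) ^ j := by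
  have h := FormalMultilinearSeries.summable_norm_mul_pow _ hr
  simpa [FormalMultilinearSeries.ofScalars_norm, abs_of_nonneg (majorantCoeff_nonneg 𝕜 X Y _)]
    using h

lemma enorm_psi_sub_exp_le [CompleteSpace A] (X Y : A) {q r : ℝ≥0} (hr : r < rz 𝕜 X Y)
    (hq : q ≤ 1) {z : 𝕜} (hz : ‖z‖₊ ≤ q * r) (n : ℕ) :
    ‖Psi 𝕜 X Y (n + 1) z - NormedSpace.exp (z • (X + Y))‖ₑ ≤ (q : ℝ≥0∞) ^ (n + 2) *
      (2 * ENNReal.ofReal (Real.exp (∑' j, majorantCoeff 𝕜 X Y j * (r : ℝ) ^ j))) := by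
  have hM := summable_majorantCoeff 𝕜 X Y hr
  have hM0 : ∀ j, 0 ≤ majorantCoeff 𝕜 X Y j * (r : ℝ) ^ j := fun j =>
    mul_nonneg (majorantCoeff_nonneg 𝕜 X Y j) (by positivity)
  have hP := ((expBound_leftS 𝕜 X Y r n).mul (expBound_rightS 𝕜 X Y r n)).mono
    ((add_halves _).trans_le (hM.sum_le_tsum _ fun j _ => hM0 j))
  have hS := (expBound_expS 𝕜 r one_pos (X + Y)).mono
    (b := ∑' j, majorantCoeff 𝕜 X Y j * (r : ℝ) ^ j) (by
    refine le_trans ?_ (hM.le_tsum 1 fun j _ => hM0 j)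
    rw [majorantCoeff, if_neg one_ne_zero, if_pos rfl]
    gcongr
    exact norm_add_le X Y)
  have hE := (evals_psi X Y n z).2.sub (evals_expS z one_pos (X + Y)).2
  simp only [← smul_sub, ← map_sub, pow_one] at hE
  refine (enorm_le_of_coeff_eq_zero hE (N := n + 2) (fun i hi => ?_) hq hz).trans ?_
  · rw [map_sub, coeff_leftS_mul_rightS 𝕜 X Y hi, sub_self]
  · gcongr
    rw [← sub_sub_sub_cancel_right _ _ (1 : A⟦X⟧), sub_eq_add_neg, two_mul]
    refine (wnorm_add_le _ _ _).trans ?_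
    rw [wnorm_neg]
    exact add_le_add hP.wnorm_le hS.wnorm_le

lemma tendstoUniformlyOn_psi [CompleteSpace A] (X Y : A) {K : Set 𝕜} (hK : IsCompact K)
    (hKr : K ⊆ Metric.eball (0 : 𝕜) (rz 𝕜 X Y)) :
    TendstoUniformlyOn (fun (n : ℕ) (z : 𝕜) => Psi 𝕜 X Y n z)
      (fun z : 𝕜 => NormedSpace.exp (z • (X + Y))) atTop K := by
  rcases K.eq_empty_or_nonempty with rfl | hne
  · exact tendstoUniformlyOn_empty
  obtain ⟨w, hw, hmax⟩ := hK.exists_isMaxOn hne continuous_nnnorm.continuousOn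
  have hwr : (‖w‖₊ : ℝ≥0∞) < rz 𝕜 X Y := by
    have := hKr hw
    rwa [Metric.mem_eball, edist_zero_right] at this
  obtain ⟨r, hwr', hr⟩ := ENNReal.lt_iff_exists_nnreal_btwn.1 hwr
  have hwr'' : ‖w‖₊ < r := by exact_mod_cast hwr'
  have hr0 : r ≠ 0 := (pos_of_gt hwr'').ne'
  have hq : ‖w‖₊ / r < 1 := (div_lt_one₀ (pos_of_gt hwr'')).2 hwr''
  have hlim : Tendsto (fun n : ℕ => ((‖w‖₊ / r : ℝ≥0) : ℝ≥0∞) ^ (n + 2) *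
      (2 * ENNReal.ofReal (Real.exp (∑' j, majorantCoeff 𝕜 X Y j * (r : ℝ) ^ j)))) atTop (𝓝 0) := by
    have h1 := (tendsto_add_atTop_iff_nat 2).2
      (ENNReal.tendsto_pow_atTop_nhds_zero_of_lt_one (ENNReal.coe_lt_one_iff.2 hq))
    have h2 := ENNReal.Tendsto.mul_const (b := 2 * ENNReal.ofReal
      (Real.exp (∑' j, majorantCoeff 𝕜 X Y j * (r : ℝ) ^ j))) h1
      (Or.inr (ENNReal.mul_ne_top (by simp) ENNReal.ofReal_ne_top))
    simpa using h2
  rw [EMetric.tendstoUniformlyOn_iff]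
  intro ε hε
  obtain ⟨N, hN⟩ := eventually_atTop.1 (hlim.eventually (gt_mem_nhds hε))
  refine eventually_atTop.2 ⟨N + 1, fun n hn z hz => ?_⟩
  obtain ⟨n, rfl⟩ := Nat.exists_eq_succ_of_ne_zero (show n ≠ 0 by omega)
  rw [edist_comm, edist_eq_enorm_sub]
  refine (enorm_psi_sub_exp_le X Y hr hq.le ?_ n).trans_lt (hN n (by omega))
  rw [div_mul_cancel₀ _ hr0]
  exact hmax hz

end Analytic

end

end SymZassenhaus


theorem mainTheorem2 {𝕜 : Type*} [RCLike 𝕜] {A : Type*} [NormedRing A] [NormedAlgebra 𝕜 A]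
    [CompleteSpace A] (X Y : A) :
    (∀ z ∈ Metric.eball (0 : 𝕜) (SymZassenhaus.rz 𝕜 X Y),
      Tendsto (fun n : ℕ => SymZassenhaus.Psi 𝕜 X Y n z) atTop
        (𝓝 (NormedSpace.exp (z • (X + Y))))) ∧
    (∀ K : Set 𝕜, IsCompact K → K ⊆ Metric.eball (0 : 𝕜) (SymZassenhaus.rz 𝕜 X Y) →
      TendstoUniformlyOn (fun (n : ℕ) (z : 𝕜) => SymZassenhaus.Psi 𝕜 X Y n z)
        (fun z : 𝕜 => NormedSpace.exp (z • (X + Y))) atTop K) :=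
  ⟨fun z hz => (SymZassenhaus.tendstoUniformlyOn_psi X Y isCompact_singleton
      (Set.singleton_subset_iff.2 hz)).tendsto_at (Set.mem_singleton z),
    fun _ hK hKr => SymZassenhaus.tendstoUniformlyOn_psi X Y hK hKr⟩
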